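/- Let $n\ge 2$ be even and let $x=(x_1,\dots,x_n)$. Let $\lambda<0$ and $f(T)=A_1T$ with $A_1<0$. Let $R(z)=\sum_{l=1}^{k}d_{2l}z^{2l}$ with $k\ge 1$ and $d_{2l}>0$ for $l=1,\dots,k$. For $j=1,\dots,n/2$ let $a_{2j-1},a_{2j}\in\mathbb{R}[x_1,\dots,x_{2j-2}]$ (so $a_1,a_2\in\mathbb{R}$) be such that $a_{2j-1}=a_{2j}$ or $a_{2j-1}=-a_{2j}$, and such that $a_{2j-1}^2<\lambda/A_1$ at every point (so that $a_{2j-1}$ is in fact constant). Let $H=(H_1,\dots,H_n)$, where $$H_{2j-1}=a_{2j}\,f(a_{2j-1}x_{2j-1}+a_{2j}x_{2j}),\qquad H_{2j}=-a_{2j-1}\,f(a_{2j-1}x_{2j-1}+a_{2j}x_{2j}),\qquad j=1,\dots,n/2,$$ and let $F:\mathbb{R}^{n+1}\to\mathbb{R}^{n+1}$ be the vector field $$F(x,x_{n+1})=\bigl(-x_2,x_1,-x_4,x_3,\dots,-x_n,x_{n-1},\,-x_{n+1}R(x_{n+1})\bigr)+R(x_{n+1})\,\bigl(\lambda x+H(x),\,0\bigr).$$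 Then the origin is an almost global attractor of $\dot{x}=F(x)$: it is an equilibrium, and for all initial states outside a set of Lebesgue measure zero the trajectory exists on $[0,\infty)$ and converges to the origin as $t\to\infty$. However, the origin is not locally asymptotically stable, i.e. it is not both Lyapunov stable and attracting for all initial states in some neighbourhood of it. -/

import Mathlib

open Filter Topology MeasureTheory Polynomial

noncomputable section

/-- `γ` solves `ẋ = F(x)`, `x(0) = x₀`, on the whole half-line `[0, ∞)`
(with the one-sided derivative at `0`). -/
def IsForwardSolution {E : Type*} [NormedAddCommGroup E] [NormedSpace ℝ E]
    (F : E → E) (x₀ : E) (γ : ℝ → E) : Prop :=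
  γ 0 = x₀ ∧ IsIntegralCurveOn γ (fun _ => F) (Set.Ici 0)

/-- The trajectory of `ẋ = F(x)` that starts at `x₀` exists on `[0, ∞)` and tends to the origin. -/
def TrajectoryTendsToZero {E : Type*} [NormedAddCommGroup E] [NormedSpace ℝ E]
    (F : E → E) (x₀ : E) : Prop :=
  (∃ γ : ℝ → E, IsForwardSolution F x₀ γ) ∧
    ∀ γ : ℝ → E, IsForwardSolution F x₀ γ → Tendsto γ atTop (𝓝 0)

/-- The origin is an equilibrium of `ẋ = F(x)`, and it attracts all initial states outside a set
of Lebesgue measure zero. -/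
def OriginIsAlmostGlobalAttractor {d : ℕ}
    (F : EuclideanSpace ℝ (Fin d) → EuclideanSpace ℝ (Fin d)) : Prop :=
  F 0 = 0 ∧ ∀ᵐ x₀ ∂(volume : Measure (EuclideanSpace ℝ (Fin d))), TrajectoryTendsToZero F x₀

/-- The origin is a locally asymptotically stable equilibrium of `ẋ = F(x)`:
it is Lyapunov stable and it attracts all initial states in some neighbourhood. -/
def OriginIsLocallyAsymptoticallyStable {E : Type*} [NormedAddCommGroup E] [NormedSpace ℝ E]
    (F : E → E) : Prop :=
  F 0 = 0 ∧
  (∀ ε > (0 : ℝ), ∃ δ > (0 : ℝ), ∀ x₀ : E, ‖x₀‖ < δ →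
    ∀ γ : ℝ → E, IsForwardSolution F x₀ γ → ∀ t : ℝ, 0 ≤ t → ‖γ t‖ < ε) ∧
  (∃ δ > (0 : ℝ), ∀ x₀ : E, ‖x₀‖ < δ → TrajectoryTendsToZero F x₀)

/-- `f(T) = ∑_{i=0}^{s} A_{2i+1} T^{2i+1}`. -/
def oddPoly (s : ℕ) (A : ℕ → ℝ) : ℝ[X] :=
  ∑ i ∈ Finset.range (s + 1), C (A (2 * i + 1)) * X ^ (2 * i + 1)

/-- `R(z) = ∑_{l=1}^{k} d_{2l} z^{2l}`. -/
def evenPoly (k : ℕ) (d : ℕ → ℝ) : ℝ[X] :=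
  ∑ l ∈ Finset.Icc 1 k, C (d (2 * l)) * X ^ (2 * l)

/-- The value at `x = (x₁, …, x_{2m})` of a polynomial in the first `2 * j` variables, `j < m`. -/
def evalFirst {m : ℕ} (j : Fin m) (p : MvPolynomial (Fin (2 * (j : ℕ))) ℝ)
    (x : Fin (2 * m) → ℝ) : ℝ :=
  MvPolynomial.eval (fun l : Fin (2 * (j : ℕ)) => x ⟨l, by omega⟩) p

/-- The rotation `(-x₂, x₁, -x₄, x₃, …, -x_{2m}, x_{2m-1})`. -/
def rotationField {m : ℕ} (x : Fin (2 * m) → ℝ) : Fin (2 * m) → ℝ := fun i =>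
  if h : (i : ℕ) % 2 = 0 then -x ⟨i + 1, by omega⟩ else x ⟨i - 1, by omega⟩

/-- The map `H` whose coordinates number `2j - 1` and `2j` (`j = 1, …, m`) are
`a_{2j} f(a_{2j-1} x_{2j-1} + a_{2j} x_{2j})` and `-a_{2j-1} f(a_{2j-1} x_{2j-1} + a_{2j} x_{2j})`,
where `a_{2j-1}`, `a_{2j}` are polynomials in `x₁, …, x_{2j-2}`.
With `j` counted from `0`, `p j` is `a_{2j+1}` and `q j` is `a_{2j+2}`. -/
def nilpotentMap {m : ℕ} (f : ℝ[X]) (p q : (j : Fin m) → MvPolynomial (Fin (2 * (j : ℕ))) ℝ)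
    (x : Fin (2 * m) → ℝ) : Fin (2 * m) → ℝ := fun i =>
  let j : Fin m := ⟨(i : ℕ) / 2, by omega⟩
  let a : ℝ := evalFirst j (p j) x
  let b : ℝ := evalFirst j (q j) x
  let v : ℝ := f.eval (a * x ⟨2 * j, by omega⟩ + b * x ⟨2 * j + 1, by omega⟩)
  if (i : ℕ) % 2 = 0 then b * v else -a * v

/-- The vector field on `ℝ^{2m+1}` which at `(x, z)`, `x ∈ ℝ^{2m}`, `z ∈ ℝ`, takes the value
`(rotation of x, -z R(z)) + R(z) (λ x + H(x), 0)`. -/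
def hurwitzField {m : ℕ} (lam : ℝ) (f R : ℝ[X])
    (p q : (j : Fin m) → MvPolynomial (Fin (2 * (j : ℕ))) ℝ)
    (w : EuclideanSpace ℝ (Fin (2 * m + 1))) : EuclideanSpace ℝ (Fin (2 * m + 1)) :=
  let x : Fin (2 * m) → ℝ := fun i => w i.castSucc
  let z : ℝ := w (Fin.last (2 * m))
  WithLp.toLp 2 (Fin.snoc (α := fun _ => ℝ)
    (fun i => rotationField x i + R.eval z * (lam * x i + nilpotentMap f p q x i))
    (-z * R.eval z))

end

/-! Write a point as `(x, z)`. The rotation is orthogonal to `x`, and since `a_{2j-1} = ±a_{2j}`,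
the pair number `j` adds at most `R(z) (λ - A₁ a_{2j-1}²)` times its squared length to `x · ẋ`; this
factor is nonpositive because `a_{2j-1}² < λ / A₁` and `A₁ < 0` (`sum_mul_field_le`). So the norm
never increases and solutions are global.

If `z(0) ≠ 0`, then `z` never vanishes and tends to `0`. On the ball that contains the orbit, `V =
|x|²` satisfies `V̇ ≤ -2c R(z) V` with some `c > 0`, while `u = z²` satisfies `u̇ = -2 R(z) u`.
Hence `V` is at most a constant times `u ^ c` and tends to `0`: no rate for `z` is needed, since
`R(z)` drives both decays.

The exceptional hyperplane `z = 0` is null. On it `R` vanishes and the field is a pure rotation, so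
arbitrarily small circles are orbits. What fails at the origin is local attraction, not Lyapunov
stability. -/

theorem antitoneOn_Ici_of_hasDerivWithinAt {g g' : ℝ → ℝ}
    (hg : ∀ t ∈ Set.Ici (0 : ℝ), HasDerivWithinAt g (g' t) (Set.Ici 0) t)
    (hg' : ∀ t ∈ Set.Ici (0 : ℝ), g' t ≤ 0) : AntitoneOn g (Set.Ici 0) := by
  have key : ∀ t ∈ interior (Set.Ici (0 : ℝ)), HasDerivAt g (g' t) t := fun t ht =>
    (hg t (interior_subset ht)).hasDerivAt (mem_interior_iff_mem_nhds.1 ht)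
  refine antitoneOn_of_deriv_nonpos (convex_Ici 0) (fun t ht => (hg t ht).continuousWithinAt)
    (fun t ht => (key t ht).differentiableAt.differentiableWithinAt) fun t ht => ?_
  rw [(key t ht).deriv]
  exact hg' t (interior_subset ht)

/-! ### Global forward existence -/

section Existence

/-- A bounded, globally Lipschitz vector field has a forward solution from every point. -/
theorem exists_isForwardSolution_of_lipschitzWith {E : Type*} [NormedAddCommGroup E]
    [NormedSpace ℝ E] [CompleteSpace E] {G : E → E} {K L : NNReal} (hK : LipschitzWith K G)
    (hL : ∀ x, ‖G x‖ ≤ L) (x₀ : E) : ∃ γ, IsForwardSolution G x₀ γ := by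
  have hex : ∀ n : ℕ, ∃ α : ℝ → E, α 0 = x₀ ∧ ∀ t ∈ Set.Icc (0 : ℝ) (n + 1),
      HasDerivWithinAt α (G (α t)) (Set.Icc (0 : ℝ) (n + 1)) t := by
    intro n
    have h0 : (0 : ℝ) ∈ Set.Icc (0 : ℝ) (n + 1) := ⟨le_rfl, by positivity⟩
    -- At speed at most `L` a solution moves at most `L * (n + 1)` in time `n + 1`, so a ball of
    -- this radius never shortens the interval.
    have hP : IsPicardLindelof (fun _ => G) (⟨0, h0⟩ : Set.Icc (0 : ℝ) (n + 1)) x₀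
        (L * (n + 1)) 0 L K := by
      refine IsPicardLindelof.of_time_independent (fun x _ => hL x) hK.lipschitzOnWith ?_
      have : max ((n : ℝ) + 1) 0 = n + 1 := max_eq_left (by positivity)
      simp [this]
    exact hP.exists_eq_forall_mem_Icc_hasDerivWithinAt₀
  choose α hα0 hα using hex
  have hder : ∀ (n : ℕ) (t : ℝ), 0 ≤ t → t < n + 1 →
      HasDerivWithinAt (α n) (G (α n t)) (Set.Ici 0) t := by
    intro n t h0 h1
    refine (hα n t ⟨h0, h1.le⟩).mono_of_mem_nhdsWithin ?_
    rw [← Set.Ici_inter_Iic]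
    exact inter_mem self_mem_nhdsWithin (mem_nhdsWithin_of_mem_nhds (Iic_mem_nhds h1))
  have hagree : ∀ (n N : ℕ), n ≤ N → ∀ t ∈ Set.Icc (0 : ℝ) (n + 1), α n t = α N t := by
    intro n N hnN
    have hc : (n : ℝ) ≤ N := by exact_mod_cast hnN
    refine ODE_solution_unique (v := fun _ => G) (K := K) (fun _ => hK)
      (fun t ht => (hα n t ht).continuousWithinAt) (fun t ht => ?_)
      (fun t ht => ((hα N t ⟨ht.1, ht.2.trans (by linarith)⟩).continuousWithinAt).mono
        (Set.Icc_subset_Icc_right (by linarith))) (fun t ht => ?_) (by rw [hα0, hα0])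
    · exact (hder n t ht.1 ht.2).mono (Set.Ici_subset_Ici.2 ht.1)
    · exact (hder N t ht.1 (by linarith [ht.2])).mono (Set.Ici_subset_Ici.2 ht.1)
  -- The pieces glue: below time `N + 1` the diagonal choice is the single solution `α N`. The extra
  -- unit of time keeps `t` away from the right end of the interval of `α ⌊t⌋₊`.
  have hγ : ∀ (N : ℕ) (t : ℝ), 0 ≤ t → t < N + 1 → α ⌊t⌋₊ t = α N t := by
    intro N t h0 h1
    refine hagree _ _ ?_ t ⟨h0, (Nat.lt_floor_add_one t).le⟩
    have : ⌊t⌋₊ < N + 1 := (Nat.floor_lt h0).2 (by exact_mod_cast h1)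
    omega
  refine ⟨fun t => α ⌊t⌋₊ t, by simp [hα0], fun t ht => ?_⟩
  have ht0 : 0 ≤ t := ht
  have ht1 : t < ⌊t⌋₊ + 1 := Nat.lt_floor_add_one t
  refine (hder ⌊t⌋₊ t ht0 ht1).congr_of_eventuallyEq ?_ rfl
  filter_upwards [self_mem_nhdsWithin, mem_nhdsWithin_of_mem_nhds (Iio_mem_nhds ht1)] with s h0 h1
  exact hγ _ s h0 h1

variable {E : Type*} [NormedAddCommGroup E] [InnerProductSpace ℝ E]

theorem IsForwardSolution.antitoneOn_norm_sq {G : E → E} {x₀ : E} {γ : ℝ → E}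
    (hγ : IsForwardSolution G x₀ γ) (hG : ∀ x, inner ℝ x (G x) ≤ 0) :
    AntitoneOn (fun t => ‖γ t‖ ^ 2) (Set.Ici 0) :=
  antitoneOn_Ici_of_hasDerivWithinAt (fun t ht => (hγ.2 t ht).norm_sq)
    fun t _ => by linarith [hG (γ t)]

theorem IsForwardSolution.norm_le {G : E → E} {x₀ : E} {γ : ℝ → E}
    (hγ : IsForwardSolution G x₀ γ) (hG : ∀ x, inner ℝ x (G x) ≤ 0) {t : ℝ} (ht : 0 ≤ t) :
    ‖γ t‖ ≤ ‖x₀‖ := by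
  have := hγ.antitoneOn_norm_sq hG (Set.mem_Ici.2 le_rfl) ht ht
  simp only [hγ.1] at this
  exact le_of_sq_le_sq this (norm_nonneg _)

/-- A `C¹` vector field that does not increase the norm has a forward solution from every point:
cut the field off outside a large ball. -/
theorem exists_isForwardSolution_of_inner_nonpos [FiniteDimensional ℝ E] {F : E → E}
    (hF : ContDiff ℝ 1 F) (hd : ∀ x, inner ℝ x (F x) ≤ 0) (x₀ : E) :
    ∃ γ, IsForwardSolution F x₀ γ := by
  let b : ContDiffBump (0 : E) := ⟨‖x₀‖ + 1, ‖x₀‖ + 2, by positivity, by linarith⟩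
  let G : E → E := fun x => b x • F x
  have hGc : ContDiff ℝ 1 G := b.contDiff.smul hF
  have hGs : HasCompactSupport G := b.hasCompactSupport.smul_right
  obtain ⟨K, hK⟩ := hGc.lipschitzWith_of_hasCompactSupport hGs one_ne_zero
  obtain ⟨C, hC⟩ := hGs.exists_bound_of_continuous hGc.continuous
  -- A nonnegative cutoff preserves the sign, so the solution stays where the cutoff equals `1` and
  -- solves the original equation.
  have hGd : ∀ x, inner ℝ x (G x) ≤ 0 := fun x => by
    rw [inner_smul_right]
    exact mul_nonpos_of_nonneg_of_nonpos b.nonneg (hd x)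
  obtain ⟨γ, hγ⟩ := exists_isForwardSolution_of_lipschitzWith (L := C.toNNReal) hK
    (fun x => (hC x).trans (Real.le_coe_toNNReal C)) x₀
  refine ⟨γ, hγ.1, fun t ht => ?_⟩
  have h1 : b (γ t) = 1 := b.one_of_mem_closedBall <| by
    simpa [b] using (hγ.norm_le hGd ht).trans (by linarith)
  simpa [G, h1] using hγ.2 t ht

end Existence

/-! ### Scalar decay and comparison -/

section Decay

/-- Solutions of `ż = -z R(z)` with `R` positive away from `0` do not vanish and tend to `0`. -/
theorem ne_zero_and_tendsto_zero_of_scalar_ode {R z : ℝ → ℝ} (hR : Continuous R)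
    (hR0 : ∀ v, 0 ≤ R v) (hRpos : ∀ v, v ≠ 0 → 0 < R v)
    (hz : ∀ t ∈ Set.Ici (0 : ℝ), HasDerivWithinAt z (-z t * R (z t)) (Set.Ici 0) t)
    (hz0 : z 0 ≠ 0) :
    (∀ t, 0 ≤ t → z t ≠ 0) ∧ Tendsto (fun t => z t ^ 2) atTop (𝓝 0) := by
  have hd : ∀ t ∈ Set.Ici (0 : ℝ), HasDerivWithinAt (fun s => z s ^ 2)
      (-2 * R (z t) * z t ^ 2) (Set.Ici 0) t := fun t ht => by
    have := (hz t ht).fun_pow 2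
    refine this.congr_deriv ?_
    norm_num
    ring
  have hanti : AntitoneOn (fun s => z s ^ 2) (Set.Ici 0) :=
    antitoneOn_Ici_of_hasDerivWithinAt hd fun t _ => by nlinarith [hR0 (z t), sq_nonneg (z t)]
  have hle : ∀ t, 0 ≤ t → z t ^ 2 ≤ z 0 ^ 2 := fun t ht => hanti (Set.mem_Ici.2 le_rfl) ht ht
  have habs : ∀ t, 0 ≤ t → z t ∈ Set.Icc (-|z 0|) |z 0| := fun t ht =>
    abs_le.1 (sq_le_sq.1 (hle t ht))
  constructor
  · obtain ⟨M, hM⟩ := isCompact_Icc.exists_bound_of_continuousOn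
      (hR.continuousOn (s := Set.Icc (-|z 0|) |z 0|))
    -- With `R ≤ M` along the orbit, `z²` decays no faster than `exp (-2Mt)`, so it cannot reach `0`
    -- in finite time.
    have hmono : AntitoneOn (fun s => -(z s ^ 2 * Real.exp (2 * M * s))) (Set.Ici 0) := by
      refine antitoneOn_Ici_of_hasDerivWithinAt (g' := fun t =>
        -(-2 * R (z t) * z t ^ 2 * Real.exp (2 * M * t)
          + z t ^ 2 * (Real.exp (2 * M * t) * (2 * M)))) (fun t ht => ?_) fun t ht => ?_
      · have he : HasDerivWithinAt (fun s : ℝ => Real.exp (2 * M * s))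
            (Real.exp (2 * M * t) * (2 * M)) (Set.Ici 0) t := by
          simpa using (((hasDerivAt_id t).const_mul (2 * M)).exp).hasDerivWithinAt
        exact ((hd t ht).mul he).neg
      · have h1 : R (z t) ≤ M := (le_abs_self _).trans (hM _ (habs t ht))
        have h2 : 0 ≤ (M - R (z t)) * (z t ^ 2 * Real.exp (2 * M * t)) :=
          mul_nonneg (by linarith) (by positivity)
        linarith
    intro t ht h0
    have := hmono (Set.mem_Ici.2 le_rfl) ht ht
    simp only [h0] at this
    have hpos : 0 < z 0 ^ 2 := by positivity
    simp at this
    exact hz0 (by nlinarith)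
  · rw [Metric.tendsto_atTop]
    intro ε hε
    suffices h : ∃ T, 0 ≤ T ∧ z T ^ 2 < ε by
      obtain ⟨T, hT, hTε⟩ := h
      refine ⟨T, fun t ht => ?_⟩
      rw [Real.dist_0_eq_abs, abs_of_nonneg (sq_nonneg _)]
      exact (hanti hT (Set.mem_Ici.2 (hT.trans ht)) ht).trans_lt hTε
    -- If `z²` stayed above `ε`, then `R` would have a positive minimum on the values taken, and
    -- `z²` would fall at least linearly, reaching `0` by the time `z 0 ^ 2 / (2 * R v * ε)`.
    by_contra! hge
    have hK : IsCompact (Set.Icc (-|z 0|) |z 0| ∩ {v : ℝ | ε ≤ v ^ 2}) :=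
      isCompact_Icc.inter_right (isClosed_le continuous_const (by fun_prop))
    obtain ⟨v, hv, hmin⟩ := hK.exists_isMinOn ⟨z 0, habs 0 le_rfl, hge 0 le_rfl⟩ hR.continuousOn
    have hc : 0 < R v := hRpos v fun h => by
      have : ε ≤ v ^ 2 := hv.2
      rw [h] at this
      norm_num at this
      linarith
    have hanti' : AntitoneOn (fun s => z s ^ 2 + 2 * R v * ε * s) (Set.Ici 0) := by
      refine antitoneOn_Ici_of_hasDerivWithinAt (g' := fun t => -2 * R (z t) * z t ^ 2
        + 2 * R v * ε) (fun t ht => ?_) fun t ht => ?_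
      · have := ((hasDerivAt_id t).const_mul (2 * R v * ε)).hasDerivWithinAt (s := Set.Ici 0)
        simpa using (hd t ht).fun_add this
      · have h1 : R v ≤ R (z t) := hmin ⟨habs t ht, hge t ht⟩
        have h2 : R v * ε ≤ R (z t) * z t ^ 2 := mul_le_mul h1 (hge t ht) hε.le (hR0 _)
        linarith
    have hT : 0 ≤ z 0 ^ 2 / (2 * R v * ε) := by positivity
    have h1 := hanti' (Set.mem_Ici.2 le_rfl) hT hT
    have h2 := hge _ hT
    have h3 : 2 * R v * ε * (z 0 ^ 2 / (2 * R v * ε)) = z 0 ^ 2 := by field_simp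
    simp only [h3, mul_zero, add_zero] at h1
    linarith

/-- If `u̇ = -2 r u`, `u → 0` and `V̇ ≤ -2 c r V`, then `V` is dominated by `u ^ c`. -/
theorem tendsto_zero_of_comparison {V V' u r : ℝ → ℝ} {c : ℝ} (hc : 0 < c)
    (hV : ∀ t ∈ Set.Ici (0 : ℝ), HasDerivWithinAt V (V' t) (Set.Ici 0) t)
    (hu : ∀ t ∈ Set.Ici (0 : ℝ), HasDerivWithinAt u (-2 * r t * u t) (Set.Ici 0) t)
    (hV' : ∀ t ∈ Set.Ici (0 : ℝ), V' t ≤ -2 * c * r t * V t)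
    (hV0 : ∀ t, 0 ≤ V t) (hu0 : ∀ t ∈ Set.Ici (0 : ℝ), 0 < u t)
    (hlim : Tendsto u atTop (𝓝 0)) : Tendsto V atTop (𝓝 0) := by
  -- The derivative is `(V' + 2 c r V) u ^ (-c)`, which is nonpositive by `hV'`.
  have hanti : AntitoneOn (fun t => V t * u t ^ (-c)) (Set.Ici 0) := by
    refine antitoneOn_Ici_of_hasDerivWithinAt (fun t ht =>
      (hV t ht).mul ((hu t ht).rpow_const (Or.inl (hu0 t ht).ne'))) fun t ht => ?_
    have hpow : u t * u t ^ (-c - 1) = u t ^ (-c) := by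
      rw [Real.rpow_sub_one (hu0 t ht).ne', mul_div_cancel₀ _ (hu0 t ht).ne']
    have h1 : 0 ≤ (-2 * c * r t * V t - V' t) * u t ^ (-c) :=
      mul_nonneg (by linarith [hV' t ht]) (Real.rpow_nonneg (hu0 t ht).le _)
    have h2 : V t * (-2 * r t * u t * -c * u t ^ (-c - 1)) = 2 * c * r t * V t * u t ^ (-c) := by
      rw [← hpow]; ring
    rw [h2]
    linarith
  have hbound : ∀ t ∈ Set.Ici (0 : ℝ), V t ≤ V 0 * u 0 ^ (-c) * u t ^ c := fun t ht => by
    have h1 := hanti (Set.mem_Ici.2 le_rfl) ht ht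
    have h2 := mul_le_mul_of_nonneg_right h1 (Real.rpow_nonneg (hu0 t ht).le c)
    simp only [mul_assoc, ← Real.rpow_add (hu0 t ht)] at h2 ⊢
    simpa using h2
  have hlim' : Tendsto (fun t => V 0 * u 0 ^ (-c) * u t ^ c) atTop (𝓝 0) := by
    have := (hlim.rpow_const (p := c) (Or.inr hc.le)).const_mul (V 0 * u 0 ^ (-c))
    simpa [Real.zero_rpow hc.ne'] using this
  refine tendsto_of_tendsto_of_tendsto_of_le_of_le' tendsto_const_nhds hlim'
    (Eventually.of_forall hV0) ?_
  filter_upwards [eventually_ge_atTop 0] with t ht using hbound t ht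

end Decay

/-! ### Polynomials, pairing of coordinates, smoothness -/

theorem eval_oddPoly_of_eq_zero {s : ℕ} {A : ℕ → ℝ}
    (hA : ∀ i, 1 ≤ i → i ≤ s → A (2 * i + 1) = 0) (T : ℝ) :
    (oddPoly s A).eval T = A 1 * T := by
  rw [oddPoly, eval_finsetSum, Finset.sum_range_succ', Finset.sum_eq_zero]
  · simp
  · intro i hi
    simp [hA (i + 1) (by omega) (by simpa using hi)]

theorem eval_evenPoly (k : ℕ) (d : ℕ → ℝ) (z : ℝ) :
    (evenPoly k d).eval z = ∑ l ∈ Finset.Icc 1 k, d (2 * l) * z ^ (2 * l) := by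
  simp [evenPoly, eval_finsetSum]

theorem eval_evenPoly_zero (k : ℕ) (d : ℕ → ℝ) : (evenPoly k d).eval 0 = 0 := by
  rw [eval_evenPoly]
  refine Finset.sum_eq_zero fun l hl => ?_
  have : 2 * l ≠ 0 := by have := (Finset.mem_Icc.1 hl).1; omega
  simp [zero_pow this]

theorem eval_evenPoly_nonneg {k : ℕ} {d : ℕ → ℝ} (hd : ∀ l, 1 ≤ l → l ≤ k → 0 < d (2 * l))
    (z : ℝ) : 0 ≤ (evenPoly k d).eval z := by
  rw [eval_evenPoly]
  refine Finset.sum_nonneg fun l hl => ?_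
  obtain ⟨h1, h2⟩ := Finset.mem_Icc.1 hl
  exact mul_nonneg (hd l h1 h2).le ((even_two_mul l).pow_nonneg z)

theorem eval_evenPoly_pos {k : ℕ} (hk : 1 ≤ k) {d : ℕ → ℝ}
    (hd : ∀ l, 1 ≤ l → l ≤ k → 0 < d (2 * l)) {z : ℝ} (hz : z ≠ 0) :
    0 < (evenPoly k d).eval z := by
  rw [eval_evenPoly]
  refine Finset.sum_pos (fun l hl => ?_) ⟨1, by simp [hk]⟩
  obtain ⟨h1, h2⟩ := Finset.mem_Icc.1 hl
  exact mul_pos (hd l h1 h2) ((even_two_mul l).pow_pos hz)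

theorem Fin.sum_univ_two_mul {M : Type*} [AddCommMonoid M] (m : ℕ) (g : Fin (2 * m) → M) :
    ∑ i, g i = ∑ j : Fin m, (g ⟨2 * j, by omega⟩ + g ⟨2 * j + 1, by omega⟩) := by
  induction m with
  | zero => simp
  | succ m ih =>
    rw [Fin.sum_univ_castSucc (n := m)]
    have h := ih fun i => g ⟨i, by omega⟩
    simp only [Fin.val_castSucc, Fin.val_last]
    rw [← h]
    change ∑ i : Fin (2 * m + 1 + 1), g i = _
    rw [Fin.sum_univ_castSucc, Fin.sum_univ_castSucc, add_assoc]
    rfl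

theorem contDiff_evalFirst {m : ℕ} {n : WithTop ℕ∞} (j : Fin m)
    (p : MvPolynomial (Fin (2 * (j : ℕ))) ℝ) :
    ContDiff ℝ n (evalFirst j p) := by
  have h : ContDiff ℝ n fun y : Fin (2 * (j : ℕ)) → ℝ => MvPolynomial.eval y p :=
    (AnalyticOnNhd.eval_mvPolynomial p).contDiff
  exact h.comp (contDiff_pi.2 fun l => contDiff_apply ℝ ℝ _)

theorem contDiff_eval_polynomial {n : WithTop ℕ∞} (p : ℝ[X]) : ContDiff ℝ n (p.eval ·) :=
  (AnalyticOnNhd.eval_polynomial p).contDiff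

theorem contDiff_rotationField {m : ℕ} {n : WithTop ℕ∞} :
    ContDiff ℝ n (rotationField (m := m)) := by
  refine contDiff_pi.2 fun i => ?_
  unfold rotationField
  split_ifs <;> fun_prop

theorem contDiff_nilpotentMap {m : ℕ} {n : WithTop ℕ∞} (f : ℝ[X])
    (p q : (j : Fin m) → MvPolynomial (Fin (2 * (j : ℕ))) ℝ) :
    ContDiff ℝ n (nilpotentMap f p q) := by
  refine contDiff_pi.2 fun i => ?_
  have hp := contDiff_evalFirst (n := n) _ (p ⟨(i : ℕ) / 2, by omega⟩)
  have hq := contDiff_evalFirst (n := n) _ (q ⟨(i : ℕ) / 2, by omega⟩)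
  have hv : ContDiff ℝ n fun x : Fin (2 * m) → ℝ =>
      f.eval (evalFirst _ (p ⟨(i : ℕ) / 2, by omega⟩) x * x ⟨2 * ((i : ℕ) / 2), by omega⟩
        + evalFirst _ (q ⟨(i : ℕ) / 2, by omega⟩) x * x ⟨2 * ((i : ℕ) / 2) + 1, by omega⟩) :=
    (contDiff_eval_polynomial f).comp
      ((hp.mul (contDiff_apply ℝ ℝ _)).add (hq.mul (contDiff_apply ℝ ℝ _)))
  unfold nilpotentMap
  by_cases h : (i : ℕ) % 2 = 0
  · simpa only [h, if_true] using hq.mul hv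
  · simpa only [h, if_false] using hp.neg.mul hv

/-! ### The vector field: dissipation, attraction and circles -/

section Field

variable {m : ℕ} {lam : ℝ} {f R : ℝ[X]} {p q : (j : Fin m) → MvPolynomial (Fin (2 * (j : ℕ))) ℝ}

theorem hurwitzField_castSucc (w : EuclideanSpace ℝ (Fin (2 * m + 1))) (i : Fin (2 * m)) :
    hurwitzField lam f R p q w i.castSucc =
      rotationField (fun i => w i.castSucc) i + R.eval (w (Fin.last _)) *
        (lam * w i.castSucc + nilpotentMap f p q (fun i => w i.castSucc) i) := by
  simp [hurwitzField]

theorem hurwitzField_last (w : EuclideanSpace ℝ (Fin (2 * m + 1))) :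
    hurwitzField lam f R p q w (Fin.last _) =
      -w (Fin.last _) * R.eval (w (Fin.last _)) := by
  simp [hurwitzField]

theorem contDiff_hurwitzField {n : WithTop ℕ∞} : ContDiff ℝ n (hurwitzField lam f R p q) := by
  have hx : ContDiff ℝ n fun (w : EuclideanSpace ℝ (Fin (2 * m + 1))) (i : Fin (2 * m)) =>
      w i.castSucc := contDiff_pi.2 fun i => by fun_prop
  have hR : ContDiff ℝ n fun w : EuclideanSpace ℝ (Fin (2 * m + 1)) =>
      R.eval (w (Fin.last _)) :=
    (contDiff_eval_polynomial R).comp (by fun_prop)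
  refine contDiff_euclidean.2 fun i => ?_
  refine Fin.lastCases ?_ (fun i => ?_) i
  · simp only [hurwitzField_last]
    fun_prop
  · simp only [hurwitzField_castSucc]
    have h1 := contDiff_pi.1 (contDiff_rotationField.comp hx) i
    have h2 := contDiff_pi.1 ((contDiff_nilpotentMap f p q).comp hx) i
    simp only [Function.comp_apply] at h1 h2
    fun_prop

theorem rotationField_even (x : Fin (2 * m) → ℝ) (j : Fin m) :
    rotationField x ⟨2 * j, by omega⟩ = -x ⟨2 * j + 1, by omega⟩ := by
  simp [rotationField]

theorem rotationField_odd (x : Fin (2 * m) → ℝ) (j : Fin m) :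
    rotationField x ⟨2 * j + 1, by omega⟩ = x ⟨2 * j, by omega⟩ := by
  simp [rotationField]

theorem nilpotentMap_even (x : Fin (2 * m) → ℝ) (j : Fin m) :
    nilpotentMap f p q x ⟨2 * j, by omega⟩ = evalFirst j (q j) x *
      f.eval (evalFirst j (p j) x * x ⟨2 * j, by omega⟩
        + evalFirst j (q j) x * x ⟨2 * j + 1, by omega⟩) := by
  have h : (⟨2 * (j : ℕ) / 2, by omega⟩ : Fin m) = j := Fin.ext (by simp)
  simp only [nilpotentMap, Nat.mul_mod_right, if_true]
  rw! [h]
  simp only [Nat.mul_div_cancel_left _ two_pos]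

theorem nilpotentMap_odd (x : Fin (2 * m) → ℝ) (j : Fin m) :
    nilpotentMap f p q x ⟨2 * j + 1, by omega⟩ = -evalFirst j (p j) x *
      f.eval (evalFirst j (p j) x * x ⟨2 * j, by omega⟩
        + evalFirst j (q j) x * x ⟨2 * j + 1, by omega⟩) := by
  have h : (⟨(2 * (j : ℕ) + 1) / 2, by omega⟩ : Fin m) = j := Fin.ext (by simp; omega)
  have h' : ¬ (2 * (j : ℕ) + 1) % 2 = 0 := by omega
  simp only [nilpotentMap, h', if_false]
  rw! [h]
  simp only [show (2 * (j : ℕ) + 1) / 2 = j by omega]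

/-- The radial component of the field on the first `2m` coordinates. -/
theorem sum_mul_field_le {a c r : ℝ} (hf : ∀ T, f.eval T = a * T) (ha : a < 0) (hr : 0 ≤ r)
    (hpq : ∀ j, p j = q j ∨ p j = -q j) (x : Fin (2 * m) → ℝ)
    (hc : ∀ j, lam - a * evalFirst j (p j) x ^ 2 ≤ -c) :
    ∑ i, x i * (rotationField x i + r * (lam * x i + nilpotentMap f p q x i)) ≤
      -c * r * ∑ i, x i ^ 2 := by
  rw [Fin.sum_univ_two_mul, Fin.sum_univ_two_mul, Finset.mul_sum]
  refine Finset.sum_le_sum fun j _ => ?_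
  rw [rotationField_even, rotationField_odd, nilpotentMap_even, nilpotentMap_odd, hf]
  have hcj := hc j
  have hb : evalFirst j (p j) x = evalFirst j (q j) x ∨
      evalFirst j (p j) x = -evalFirst j (q j) x := by
    rcases hpq j with h | h
    · exact Or.inl (by rw [h])
    · exact Or.inr (by rw [h]; simp [evalFirst])
  generalize evalFirst j (p j) x = u at *
  generalize evalFirst j (q j) x = v at *
  generalize x ⟨2 * j, _⟩ = y
  generalize x ⟨2 * j + 1, _⟩ = z
  -- The pair contributes `r (lam (y² + z²) ± a u² (y² - z²))`. Its distance to the bound is `h1`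
  -- plus twice `h2` for the sign `+`, or plus twice `h3` for the sign `-`.
  have h1 : 0 ≤ r * ((-c - (lam - a * u ^ 2)) * (y ^ 2 + z ^ 2)) :=
    mul_nonneg hr (mul_nonneg (by linarith) (by positivity))
  have h2 : 0 ≤ r * (-a * (u ^ 2 * y ^ 2)) := mul_nonneg hr (mul_nonneg (by linarith) (by positivity))
  have h3 : 0 ≤ r * (-a * (u ^ 2 * z ^ 2)) := mul_nonneg hr (mul_nonneg (by linarith) (by positivity))
  rcases hb with rfl | hb
  · linarith
  · obtain rfl : v = -u := by linarith
    linarith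

/-- Compactness of the ball turns the strict pointwise inequality into a uniform one, so the
constancy of the `a_{2j-1}` need not be proved. -/
theorem exists_uniform_gap {a : ℝ} (ha : a < 0)
    (hp : ∀ (j : Fin m) (x : Fin (2 * m) → ℝ), evalFirst j (p j) x ^ 2 < lam / a) (r : ℝ) :
    ∃ c > 0, ∀ x ∈ Metric.closedBall (0 : Fin (2 * m) → ℝ) r, ∀ j : Fin m,
      lam - a * evalFirst j (p j) x ^ 2 ≤ -c := by
  have hneg : ∀ (j : Fin m) (x : Fin (2 * m) → ℝ), lam - a * evalFirst j (p j) x ^ 2 < 0 := by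
    intro j x
    have := (lt_div_iff_of_neg ha).1 (hp j x)
    linarith
  have hj : ∀ j : Fin m, ∃ c > 0, ∀ x ∈ Metric.closedBall (0 : Fin (2 * m) → ℝ) r,
      lam - a * evalFirst j (p j) x ^ 2 ≤ -c := by
    intro j
    rcases (Metric.closedBall (0 : Fin (2 * m) → ℝ) r).eq_empty_or_nonempty with h | h
    · exact ⟨1, one_pos, by simp [h]⟩
    · have hcont : Continuous fun x => lam - a * evalFirst j (p j) x ^ 2 :=
        continuous_const.sub (continuous_const.mul
          ((contDiff_evalFirst (n := 0) j (p j)).continuous.pow 2))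
      obtain ⟨y, -, hy⟩ := (isCompact_closedBall _ _).exists_isMaxOn h hcont.continuousOn
      exact ⟨_, neg_pos.2 (hneg j y), fun x hx => by rw [neg_neg]; exact hy hx⟩
  choose c hc hcx using hj
  rcases isEmpty_or_nonempty (Fin m) with _ | _
  · exact ⟨1, one_pos, fun _ _ j => isEmptyElim j⟩
  · obtain ⟨j₀, hj₀⟩ := Finite.exists_min c
    exact ⟨c j₀, hc j₀, fun x hx j => (hcx j x hx).trans (neg_le_neg (hj₀ j))⟩

theorem inner_hurwitzField_nonpos {a : ℝ} (hf : ∀ T, f.eval T = a * T) (ha : a < 0)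
    (hR : ∀ v, 0 ≤ R.eval v) (hpq : ∀ j, p j = q j ∨ p j = -q j)
    (hp : ∀ (j : Fin m) (x : Fin (2 * m) → ℝ), evalFirst j (p j) x ^ 2 < lam / a)
    (w : EuclideanSpace ℝ (Fin (2 * m + 1))) :
    inner ℝ w (hurwitzField lam f R p q w) ≤ 0 := by
  -- Rate `0` suffices here; the positive rate is available only on a ball, and this bound is what
  -- confines orbits to one.
  have h := sum_mul_field_le (c := 0) (lam := lam) hf ha (hR (w (Fin.last _))) hpq
    (fun i => w i.castSucc) fun j => by
      have := (lt_div_iff_of_neg ha).1 (hp j fun i => w i.castSucc)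
      linarith
  rw [PiLp.inner_apply, Fin.sum_univ_castSucc]
  simp only [hurwitzField_castSucc, hurwitzField_last, RCLike.inner_apply, conj_trivial]
  have h2 := mul_nonneg (hR (w (Fin.last _))) (sq_nonneg (w (Fin.last _)))
  simp only [neg_zero, zero_mul] at h
  simp only [mul_comm (_ + _) (w _)]
  linarith

theorem hurwitzField_zero (hR : R.eval 0 = 0) : hurwitzField lam f R p q 0 = 0 := by
  ext i
  refine Fin.lastCases ?_ (fun i => ?_) i
  · simp [hurwitzField_last]
  · simp [hurwitzField_castSucc, hR, rotationField]

/-- Off the invariant hyperplane `z = 0` every trajectory tends to the origin. -/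
theorem IsForwardSolution.tendsto_zero_of_hurwitzField {a : ℝ} (hf : ∀ T, f.eval T = a * T)
    (ha : a < 0) (hR : ∀ v, 0 ≤ R.eval v) (hRpos : ∀ v, v ≠ 0 → 0 < R.eval v)
    (hpq : ∀ j, p j = q j ∨ p j = -q j)
    (hp : ∀ (j : Fin m) (x : Fin (2 * m) → ℝ), evalFirst j (p j) x ^ 2 < lam / a)
    {w₀ : EuclideanSpace ℝ (Fin (2 * m + 1))} (hw₀ : w₀ (Fin.last _) ≠ 0)
    {γ : ℝ → EuclideanSpace ℝ (Fin (2 * m + 1))}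
    (hγ : IsForwardSolution (hurwitzField lam f R p q) w₀ γ) : Tendsto γ atTop (𝓝 0) := by
  have hcoord : ∀ i, ∀ t ∈ Set.Ici (0 : ℝ), HasDerivWithinAt (fun s => γ s i)
      (hurwitzField lam f R p q (γ t) i) (Set.Ici 0) t := fun i t ht =>
    (EuclideanSpace.proj (𝕜 := ℝ) i).hasFDerivAt.comp_hasDerivWithinAt t (hγ.2 t ht)
  have hz : ∀ t ∈ Set.Ici (0 : ℝ), HasDerivWithinAt (fun s => γ s (Fin.last _))
      (-γ t (Fin.last _) * R.eval (γ t (Fin.last _))) (Set.Ici 0) t := fun t ht => by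
    simpa only [hurwitzField_last] using hcoord (Fin.last _) t ht
  obtain ⟨hne, hlim⟩ := ne_zero_and_tendsto_zero_of_scalar_ode R.continuous hR hRpos hz
    (by rw [hγ.1]; exact hw₀)
  obtain ⟨c, hc, hgap⟩ := exists_uniform_gap (m := m) (p := p) ha hp ‖w₀‖
  have hball : ∀ t, 0 ≤ t →
      (fun i : Fin (2 * m) => γ t i.castSucc) ∈ Metric.closedBall 0 ‖w₀‖ := by
    intro t ht
    rw [mem_closedBall_zero_iff, pi_norm_le_iff_of_nonneg (norm_nonneg _)]
    exact fun i => (PiLp.norm_apply_le (γ t) _).trans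
      (hγ.norm_le (inner_hurwitzField_nonpos hf ha hR hpq hp) ht)
  have hV : Tendsto (fun t => ∑ i : Fin (2 * m), γ t i.castSucc ^ 2) atTop (𝓝 0) := by
    refine tendsto_zero_of_comparison (u := fun t => γ t (Fin.last _) ^ 2)
      (r := fun t => R.eval (γ t (Fin.last _))) hc
      (fun t ht => HasDerivWithinAt.fun_sum fun i _ => (hcoord i.castSucc t ht).fun_pow 2)
      (fun t ht => ((hz t ht).fun_pow 2).congr_deriv (by norm_num; ring)) (fun t ht => ?_)
      (fun t => Finset.sum_nonneg fun i _ => sq_nonneg _)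
      (fun t ht => by have := hne t ht; positivity) hlim
    have h := sum_mul_field_le (lam := lam) hf ha (hR (γ t (Fin.last _))) hpq _
      (hgap _ (hball t ht))
    simp only [← hurwitzField_castSucc] at h
    have h2 : ∑ i : Fin (2 * m), ((2 : ℕ) : ℝ) * γ t i.castSucc ^ (2 - 1) *
        hurwitzField lam f R p q (γ t) i.castSucc =
        2 * ∑ i : Fin (2 * m), γ t i.castSucc * hurwitzField lam f R p q (γ t) i.castSucc := by
      rw [Finset.mul_sum]
      exact Finset.sum_congr rfl fun i _ => by norm_num; ring
    rw [h2]
    linarith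
  have hnorm : Tendsto (fun t => ‖γ t‖ ^ 2) atTop (𝓝 0) := by
    have := hV.add hlim
    simpa [EuclideanSpace.norm_sq_eq, Fin.sum_univ_castSucc] using this
  rw [tendsto_zero_iff_norm_tendsto_zero]
  simpa using hnorm.sqrt

theorem ae_apply_ne_zero {d : ℕ} (i : Fin d) :
    ∀ᵐ w ∂(volume : Measure (EuclideanSpace ℝ (Fin d))), w i ≠ 0 := by
  let π : EuclideanSpace ℝ (Fin d) →L[ℝ] ℝ := EuclideanSpace.proj i
  -- A coordinate hyperplane is a proper subspace, hence null.
  have h : volume (LinearMap.ker π.toLinearMap : Set (EuclideanSpace ℝ (Fin d))) = 0 := by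
    refine Measure.addHaar_submodule _ _ fun h => ?_
    have : EuclideanSpace.single i (1 : ℝ) ∈ (⊤ : Submodule ℝ (EuclideanSpace ℝ (Fin d))) :=
      Submodule.mem_top
    rw [← h] at this
    simp [π] at this
  rw [ae_iff]
  convert h using 2
  ext w
  simp [π]

/-- On the hyperplane `z = 0` the field is a rotation, whose circles do not approach the origin. -/
theorem isForwardSolution_circle (hm : 1 ≤ m) (hR : R.eval 0 = 0) (ε : ℝ) :
    IsForwardSolution (hurwitzField lam f R p q)
      (EuclideanSpace.single ⟨0, by omega⟩ ε)
      (fun t => EuclideanSpace.single ⟨0, by omega⟩ (ε * Real.cos t) +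
        EuclideanSpace.single ⟨1, by omega⟩ (ε * Real.sin t)) := by
  refine ⟨by simp, fun t _ => HasDerivAt.hasDerivWithinAt ?_⟩
  have h1 : ∀ (i : Fin (2 * m + 1)) (g : ℝ → ℝ) (g' : ℝ), HasDerivAt g g' t →
      HasDerivAt (fun t => EuclideanSpace.single i (g t)) (EuclideanSpace.single i g') t := by
    intro i g g' hg
    have hs : ∀ v : ℝ, EuclideanSpace.single i v = v • EuclideanSpace.single i (1 : ℝ) := by
      intro v
      ext l
      simp
    have := hg.smul_const (EuclideanSpace.single i (1 : ℝ))
    rw [hs g']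
    exact this.congr_of_eventuallyEq (Eventually.of_forall fun y => hs (g y))
  refine ((h1 _ _ _ ((Real.hasDerivAt_cos t).const_mul ε)).add
    (h1 _ _ _ ((Real.hasDerivAt_sin t).const_mul ε))).congr_deriv ?_
  have hm0 : m ≠ 0 := by omega
  have hl1 : Fin.last (2 * m) ≠ ⟨1, by omega⟩ := fun h => by simp [Fin.ext_iff] at h
  ext i
  refine Fin.lastCases ?_ (fun i => ?_) i
  · simp [hurwitzField_last, hm0, hl1]
  · simp only [hurwitzField_castSucc]
    simp [hl1, hm0, hR, rotationField, Fin.ext_iff]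
    rcases i with ⟨i, hi⟩
    rcases i with _ | _ | i
    · simp
    · simp
    · split_ifs <;> simp_all

end Field

theorem mainTheorem4 (m : ℕ) (hm : 1 ≤ m)
    (s : ℕ) (A : ℕ → ℝ) (hA1 : A 1 < 0) (hA : ∀ i, 1 ≤ i → i ≤ s → A (2 * i + 1) = 0)
    (k : ℕ) (hk : 1 ≤ k) (d : ℕ → ℝ) (hd : ∀ l, 1 ≤ l → l ≤ k → 0 < d (2 * l))
    (lam : ℝ) (hlam : lam < 0)
    (p q : (j : Fin m) → MvPolynomial (Fin (2 * (j : ℕ))) ℝ)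
    (hpq : ∀ j, p j = q j ∨ p j = -q j)
    (hp : ∀ (j : Fin m) (x : Fin (2 * m) → ℝ), evalFirst j (p j) x ^ 2 < lam / A 1) :
    OriginIsAlmostGlobalAttractor (hurwitzField lam (oddPoly s A) (evenPoly k d) p q) ∧
    ¬ OriginIsLocallyAsymptoticallyStable
      (hurwitzField lam (oddPoly s A) (evenPoly k d) p q) := by
  have hf := eval_oddPoly_of_eq_zero hA
  have hR := eval_evenPoly_nonneg hd
  have hR0 := eval_evenPoly_zero k d
  refine ⟨⟨hurwitzField_zero hR0, ?_⟩, ?_⟩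
  · filter_upwards [ae_apply_ne_zero (Fin.last (2 * m))] with w₀ hw₀
    exact ⟨exists_isForwardSolution_of_inner_nonpos contDiff_hurwitzField
      (inner_hurwitzField_nonpos hf hA1 hR hpq hp) w₀, fun γ hγ =>
        hγ.tendsto_zero_of_hurwitzField hf hA1 hR (fun v => eval_evenPoly_pos hk hd) hpq hp hw₀⟩
  · rintro ⟨-, -, δ, hδ, h⟩
    have hlim := (h (EuclideanSpace.single ⟨0, by omega⟩ (δ / 2))
      (by simp [abs_of_pos hδ, hδ])).2 _ (isForwardSolution_circle hm hR0 (δ / 2))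
    -- Sampled at multiples of `2π`, the circle gives a constant nonzero sequence, which would have
    -- to tend to `0`.
    have hper := hlim.comp (tendsto_natCast_atTop_atTop.atTop_mul_const Real.two_pi_pos)
    have hconst : Tendsto (fun _ : ℕ => EuclideanSpace.single (⟨0, by omega⟩ : Fin (2 * m + 1))
        (δ / 2)) atTop (𝓝 0) := by
      refine hper.congr fun n => ?_
      have hs : Real.sin (n * (2 * Real.pi)) = 0 := by
        simpa using Real.sin_add_nat_mul_two_pi 0 n
      simp [Real.cos_nat_mul_two_pi, hs]
    have h0 := tendsto_nhds_unique tendsto_const_nhds hconst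
    simp [hδ.ne'] at h0
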